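/- Let $C_0(\mathbb R)$ be the C$^*$-algebra of complex-valued continuous functions on $\mathbb R$ vanishing at infinity, and let $\tau\in C_b(\mathbb R)$ be a bounded continuous complex-valued function. Let $\alpha:\mathbb R\to\mathbb R$ be a homeomorphism, with iterates $\alpha^k$, $k\in\mathbb Z$, and let $W=(w_j)_{j\in\mathbb Z}$ be a sequence in $C_b(\mathbb R)$ with $\sup_j\|w_j\|_\infty<\infty$. Let $\mathcal A=C_0(\mathbb R)$, and let $\ell^2(\mathcal A)$ be the standard Hilbert module of all sequences $a=(a_j)_{j\in\mathbb Z}$ in $\mathcal A$ such that $\sum_{j} a_j^*a_j$ converges in norm, with the norm $\|a\|_2=\|\sum_j a_j^*a_j\|_\infty^{1/2}$. For $\sigma\in C_b(\mathbb R)$ put $$\mathcal A_\sigma=\Big\{f\in \mathcal A:\ \|f\|_\sigma:=\sum_{k=0}^\infty\|f\sigma^k\|_\infty<\infty\Big\},$$ and let $$c_0^{\mathcal A,\tau}=\Big\{(s_k)_{k\in\mathbb Z}\in\prod_{k\in\mathbb Z}\mathcal A_{\tau\circ\alpha^k}:\ \lim_{k\to\infty}\|s_k\|_{\tau\circ\alpha^k}=\lim_{k\to\infty}\|s_{-k}\|_{\tau\circ\alpha^{-k}}=0\Big\},$$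 with the norm $\|s\|_0=\sup_{k\in\mathbb Z}\|s_k\|_{\tau\circ\alpha^k}$. On each of the spaces $\ell^2(\mathcal A)$ and $c_0^{\mathcal A,\tau}$ the formula $$(T_{\alpha,W}\,a)_j=w_j\cdot(a_{j-1}\circ\alpha)\qquad(j\in\mathbb Z)$$ defines a bounded linear operator. A bounded linear operator $T$ on a normed space $X$ is called hypercyclic if there is $x\in X$ whose orbit $\{T^nx:\ n\in\mathbb N\cup\{0\}\}$ is dense in $X$. If $T_{\alpha,W}$ is hypercyclic on $\ell^2(\mathcal A)$, then $T_{\alpha,W}$ is hypercyclic on $c_0^{\mathcal A,\tau}$. -/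

import Mathlib

open Filter Topology
open scoped BoundedContinuousFunction ZeroAtInfty ENNReal

noncomputable section

namespace SegalShift

/-- A bounded operator `T` is hypercyclic if some orbit `{T ^ n x : n ∈ ℕ₀}` is dense. -/
def Hypercyclic {E : Type*} [NormedAddCommGroup E] [NormedSpace ℂ E] (T : E →L[ℂ] E) : Prop :=
  ∃ x : E, Dense (Set.range fun n : ℕ => (T ^ n) x)

section HilbertModule

variable {A : Type*} [NonUnitalCommCStarAlgebra A]

/-- Minkowski's inequality for finite sequences in a commutative C⋆-algebra. -/
theorem sqrt_norm_sum_add_le (s : Finset ℤ) (x y : ℤ → A) :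
    √‖∑ j ∈ s, star ((x + y) j) * (x + y) j‖ ≤
      √‖∑ j ∈ s, star (x j) * x j‖ + √‖∑ j ∈ s, star (y j) * y j‖ := by
  let _ := CStarAlgebra.spectralOrder A
  let _ := CStarAlgebra.spectralOrderedRing A
  have key : ∀ z : ℤ → A, √‖∑ j ∈ s, star (z j) * z j‖ =
      ‖(WithCStarModule.equiv A (s → A)).symm (fun j : s => z j)‖ := by
    intro z
    rw [WithCStarModule.pi_norm, ← Finset.sum_coe_sort s]
    congr 2
    refine Finset.sum_congr rfl fun j _ => ?_
    rw [mul_comm]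
    rfl
  rw [key, key, key]
  exact norm_add_le _ _

variable (A) in
/-- The sequences `(a_j)_{j ∈ ℤ}` in `A` for which `∑ a_j⋆ a_j` converges in norm. -/
def l2Submodule : Submodule ℂ (ℤ → A) where
  carrier := {a | Summable fun j => star (a j) * a j}
  zero_mem' := by simp [summable_zero]
  add_mem' := by
    intro a b ha hb
    simp only [Set.mem_ofPred_eq] at *
    rw [summable_iff_vanishing_norm] at ha hb ⊢
    intro ε hε
    obtain ⟨s, hs⟩ := ha (ε / 4) (by positivity)
    obtain ⟨t, ht⟩ := hb (ε / 4) (by positivity)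
    refine ⟨s ∪ t, fun u hu => ?_⟩
    have h1 := hs u (Finset.disjoint_of_subset_right Finset.subset_union_left hu)
    have h2 := ht u (Finset.disjoint_of_subset_right Finset.subset_union_right hu)
    have h3 := sqrt_norm_sum_add_le u a b
    have h4 : √‖∑ j ∈ u, star (a j) * a j‖ < √(ε / 4) := Real.sqrt_lt_sqrt (norm_nonneg _) h1
    have h5 : √‖∑ j ∈ u, star (b j) * b j‖ < √(ε / 4) := Real.sqrt_lt_sqrt (norm_nonneg _) h2
    have h6 : √(ε / 4) + √(ε / 4) = √ε := by
      rw [Real.sqrt_div hε.le, show (4 : ℝ) = 2 ^ 2 by norm_num,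
        Real.sqrt_sq (by norm_num : (0 : ℝ) ≤ 2)]
      ring
    exact (Real.sqrt_lt_sqrt_iff (norm_nonneg _)).1 (by linarith)
  smul_mem' := by
    intro c a ha
    have h : (fun j => star ((c • a) j) * (c • a) j) =
        fun j => (star c * c) • (star (a j) * a j) := by
      funext j
      simp [smul_mul_smul_comm]
    simp only [Set.mem_ofPred_eq] at ha ⊢
    rw [h]
    exact ha.const_smul _

variable (A) in
/-- The standard Hilbert module `ℓ²(A)`, indexed by `ℤ`. -/
def L2 : Type _ := l2Submodule A

instance : AddCommGroup (L2 A) := inferInstanceAs (AddCommGroup (l2Submodule A))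
instance : Module ℂ (L2 A) := inferInstanceAs (Module ℂ (l2Submodule A))

/-- The norm of the standard Hilbert module, `‖a‖ = ‖∑ a_j⋆ a_j‖ ^ (1 / 2)`. -/
instance : Norm (L2 A) := ⟨fun a => √‖∑' j, star (a.1 j) * a.1 j‖⟩

theorem L2.norm_def (a : L2 A) : ‖a‖ = √‖∑' j, star (a.1 j) * a.1 j‖ := rfl

theorem L2.tendsto_norm (a : L2 A) :
    Tendsto (fun s : Finset ℤ => √‖∑ j ∈ s, star (a.1 j) * a.1 j‖) atTop (𝓝 ‖a‖) := by
  have h : Summable fun j => star (a.1 j) * a.1 j := a.2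
  exact (Real.continuous_sqrt.tendsto _).comp h.hasSum.norm

theorem L2.core : NormedSpace.Core ℂ (L2 A) where
  norm_nonneg a := Real.sqrt_nonneg _
  norm_smul c a := by
    have h : (fun j => star ((c • a).1 j) * (c • a).1 j) =
        fun j => (star c * c) • (star (a.1 j) * a.1 j) := by
      funext j
      change star (c • a.1 j) * (c • a.1 j) = _
      simp [smul_mul_smul_comm]
    have ha : Summable fun j => star (a.1 j) * a.1 j := a.2
    rw [L2.norm_def, L2.norm_def, h, ha.tsum_const_smul, norm_smul,
      Real.sqrt_mul (norm_nonneg _), norm_mul, norm_star, Real.sqrt_mul_self (norm_nonneg _)]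
  norm_triangle a b :=
    le_of_tendsto_of_tendsto' (L2.tendsto_norm (a + b)) ((L2.tendsto_norm a).add (L2.tendsto_norm b))
      fun s => sqrt_norm_sum_add_le s a.1 b.1
  norm_eq_zero_iff a := by
    constructor
    · intro h
      let _ := CStarAlgebra.spectralOrder A
      let _ := CStarAlgebra.spectralOrderedRing A
      have ha : Summable fun j => star (a.1 j) * a.1 j := a.2
      refine Subtype.ext (funext fun j => ?_)
      have h1 : ‖∑' j, star (a.1 j) * a.1 j‖ = 0 := (Real.sqrt_eq_zero (norm_nonneg _)).1 h
      have h3 : ‖star (a.1 j) * a.1 j‖ ≤ ‖∑' j, star (a.1 j) * a.1 j‖ := by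
        refine ge_of_tendsto ha.hasSum.norm ?_
        filter_upwards [eventually_ge_atTop {j}] with s hs
        refine CStarAlgebra.norm_le_norm_of_nonneg_of_le (star_mul_self_nonneg _) ?_
        exact Finset.single_le_sum (f := fun j => star (a.1 j) * a.1 j)
          (fun i _ => star_mul_self_nonneg _) (hs (Finset.mem_singleton_self j))
      rw [h1, CStarRing.norm_star_mul_self] at h3
      have h4 : ‖a.1 j‖ = 0 := by nlinarith [norm_nonneg (a.1 j)]
      exact norm_eq_zero.1 h4
    · rintro rfl
      rw [L2.norm_def]
      have : (fun j => star ((0 : L2 A).1 j) * (0 : L2 A).1 j) = fun _ => 0 := by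
        funext j
        change star (0 : A) * 0 = 0
        simp
      simp [this]

instance : NormedAddCommGroup (L2 A) := NormedAddCommGroup.ofCore L2.core
instance : NormedSpace ℂ (L2 A) := NormedSpace.ofCore L2.core

end HilbertModule

/-- Multiplication by `w ∈ C_b(ℝ)` on `C₀(ℝ)`. -/
def mulCb (w : ℝ →ᵇ ℂ) : C₀(ℝ, ℂ) →ₗ[ℂ] C₀(ℝ, ℂ) where
  toFun f :=
    { toFun := fun x => w x * f x
      continuous_toFun := by fun_prop
      zero_at_infty' := by
        have hf : Tendsto f (cocompact ℝ) (𝓝 0) := f.zero_at_infty'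
        refine squeeze_zero_norm (fun x => ?_) (by simpa using (hf.norm.const_mul ‖w‖))
        rw [norm_mul]
        exact mul_le_mul_of_nonneg_right (w.norm_coe_le_norm x) (norm_nonneg _) }
  map_add' f g := by ext x; simp [mul_add]
  map_smul' c f := by ext x; simp [mul_left_comm]

@[simp] theorem mulCb_apply (w : ℝ →ᵇ ℂ) (f : C₀(ℝ, ℂ)) (x : ℝ) : mulCb w f x = w x * f x := rfl

theorem norm_apply_le (f : C₀(ℝ, ℂ)) (x : ℝ) : ‖f x‖ ≤ ‖f‖ := f.toBCF.norm_coe_le_norm x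

theorem norm_le_of_forall {f : C₀(ℝ, ℂ)} {C : ℝ} (hC : 0 ≤ C) (h : ∀ x, ‖f x‖ ≤ C) : ‖f‖ ≤ C :=
  (BoundedContinuousFunction.norm_le hC (f := f.toBCF)).2 h

/-- The weighted composition `f ↦ w · (f ∘ α)` on `C₀(ℝ)`. -/
def weightedComp (α : ℝ ≃ₜ ℝ) (w : ℝ →ᵇ ℂ) : C₀(ℝ, ℂ) →ₗ[ℂ] C₀(ℝ, ℂ) :=
  mulCb w ∘ₗ ZeroAtInftyContinuousMap.compLinearMap α.toCocompactMap

@[simp] theorem weightedComp_apply (α : ℝ ≃ₜ ℝ) (w : ℝ →ᵇ ℂ) (f : C₀(ℝ, ℂ)) (x : ℝ) :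
    weightedComp α w f x = w x * f (α x) := rfl

/-- The common bound `sup_j ‖w_j‖_∞`. -/
def supNorm (W : ℤ → ℝ →ᵇ ℂ) : ℝ := ⨆ j, ‖W j‖

theorem supNorm_nonneg (W : ℤ → ℝ →ᵇ ℂ) : 0 ≤ supNorm W := Real.iSup_nonneg fun _ => norm_nonneg _

section ShiftL2

variable (α : ℝ ≃ₜ ℝ) (W : ℤ → ℝ →ᵇ ℂ)

theorem norm_sum_shift_le (hW : BddAbove (Set.range fun j => ‖W j‖))
    (a : ℤ → C₀(ℝ, ℂ)) (s : Finset ℤ) :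
    ‖∑ j ∈ s, star (weightedComp α (W j) (a (j - 1))) * weightedComp α (W j) (a (j - 1))‖ ≤
      supNorm W ^ 2 * ‖∑ j ∈ s, star (a (j - 1)) * a (j - 1)‖ := by
  have happ : ∀ (g : ℤ → C₀(ℝ, ℂ)) (x : ℝ),
      (∑ j ∈ s, star (g j) * g j) x = ((∑ j ∈ s, ‖g j x‖ ^ 2 : ℝ) : ℂ) := by
    intro g x
    have h1 : (∑ j ∈ s, star (g j) * g j) x = ∑ j ∈ s, (star (g j) * g j) x := by
      induction s using Finset.cons_induction with
      | empty => simp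
      | cons i t hi ih =>
        rw [Finset.sum_cons, Finset.sum_cons, ZeroAtInftyContinuousMap.add_apply, ih]
    rw [h1]
    push_cast
    refine Finset.sum_congr rfl fun j _ => ?_
    exact RCLike.conj_mul (g j x)
  refine norm_le_of_forall (by positivity) fun x => ?_
  refine le_trans ?_ (mul_le_mul_of_nonneg_left (norm_apply_le _ (α x)) (sq_nonneg _))
  rw [happ, happ (fun j => a (j - 1)), Complex.norm_real, Complex.norm_real,
    Real.norm_of_nonneg (Finset.sum_nonneg fun _ _ => sq_nonneg _),
    Real.norm_of_nonneg (Finset.sum_nonneg fun _ _ => sq_nonneg _), Finset.mul_sum]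
  refine Finset.sum_le_sum fun j _ => ?_
  rw [weightedComp_apply, norm_mul, mul_pow]
  refine mul_le_mul_of_nonneg_right ?_ (sq_nonneg _)
  exact pow_le_pow_left₀ (norm_nonneg _)
    (((W j).norm_coe_le_norm x).trans (le_ciSup hW j)) 2

theorem summable_shift {a : ℤ → C₀(ℝ, ℂ)} (ha : Summable fun j => star (a j) * a j) :
    Summable fun j => star (a (j - 1)) * a (j - 1) :=
  (Equiv.subRight (1 : ℤ)).summable_iff.2 ha

theorem summable_weighted_shift (hW : BddAbove (Set.range fun j => ‖W j‖))
    {a : ℤ → C₀(ℝ, ℂ)} (ha : Summable fun j => star (a j) * a j) :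
    Summable fun j =>
      star (weightedComp α (W j) (a (j - 1))) * weightedComp α (W j) (a (j - 1)) := by
  have h := summable_shift ha
  rw [summable_iff_vanishing_norm] at h ⊢
  intro ε hε
  have hC : 0 < supNorm W ^ 2 + 1 := by positivity
  obtain ⟨s, hs⟩ := h (ε / (supNorm W ^ 2 + 1)) (by positivity)
  refine ⟨s, fun t ht => (norm_sum_shift_le α W hW a t).trans_lt ?_⟩
  have h1 := hs t ht
  rw [lt_div_iff₀ hC] at h1
  nlinarith [norm_nonneg (∑ j ∈ t, star (a (j - 1)) * a (j - 1))]

/-- The weighted bilateral shift `(T a)_j = w_j · (a_{j-1} ∘ α)` on `ℓ²(C₀(ℝ))`. -/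
def shiftL2 (hW : BddAbove (Set.range fun j => ‖W j‖)) :
    L2 C₀(ℝ, ℂ) →L[ℂ] L2 C₀(ℝ, ℂ) :=
  LinearMap.mkContinuous
    { toFun := fun a =>
        ⟨fun j => weightedComp α (W j) (a.1 (j - 1)), summable_weighted_shift α W hW a.2⟩
      map_add' := fun a b => Subtype.ext (funext fun j => map_add (weightedComp α (W j)) _ _)
      map_smul' := fun c a => Subtype.ext (funext fun j => map_smul (weightedComp α (W j)) c _) }
    (supNorm W) (by
      intro a
      have h1 := summable_shift a.2
      have h2 := summable_weighted_shift α W hW a.2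
      have h3 : ‖∑' j, star (a.1 (j - 1)) * a.1 (j - 1)‖ = ‖∑' j, star (a.1 j) * a.1 j‖ :=
        congrArg norm ((Equiv.subRight (1 : ℤ)).tsum_eq fun j => star (a.1 j) * a.1 j)
      have h4 := le_of_tendsto_of_tendsto' h2.hasSum.norm (h1.hasSum.norm.const_mul _)
        fun s => norm_sum_shift_le α W hW a.1 s
      rw [h3] at h4
      rw [L2.norm_def a, ← Real.sqrt_sq (supNorm_nonneg W), ← Real.sqrt_mul (sq_nonneg _)]
      exact Real.sqrt_le_sqrt h4)

theorem shiftL2_apply (hW : BddAbove (Set.range fun j => ‖W j‖))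
    (a : L2 C₀(ℝ, ℂ)) (j : ℤ) :
    (shiftL2 α W hW a).1 j = weightedComp α (W j) (a.1 (j - 1)) := rfl

end ShiftL2

section Segal

/-- The functions `f ∈ C₀(ℝ)` with `∑ ‖f τ ^ k‖_∞ < ∞`. -/
def segalSubmodule (τ : ℝ →ᵇ ℂ) : Submodule ℂ C₀(ℝ, ℂ) where
  carrier := {f | Summable fun k : ℕ => ‖mulCb (τ ^ k) f‖}
  zero_mem' := by simp [summable_zero]
  add_mem' := by
    intro f g hf hg
    refine Summable.of_nonneg_of_le (fun _ => norm_nonneg _) (fun k => ?_) (hf.add hg)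
    rw [map_add]
    exact norm_add_le _ _
  smul_mem' := by
    intro c f hf
    have h : (fun k : ℕ => ‖mulCb (τ ^ k) (c • f)‖) = fun k => ‖c‖ * ‖mulCb (τ ^ k) f‖ := by
      funext k
      rw [map_smul, norm_smul]
    simp only [Set.mem_ofPred_eq] at hf ⊢
    rw [h]
    exact hf.mul_left _

/-- The Segal algebra of `C₀(ℝ)` corresponding to `τ`. -/
def Segal (τ : ℝ →ᵇ ℂ) : Type := segalSubmodule τ

variable {τ : ℝ →ᵇ ℂ}

instance : AddCommGroup (Segal τ) := inferInstanceAs (AddCommGroup (segalSubmodule τ))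
instance : Module ℂ (Segal τ) := inferInstanceAs (Module ℂ (segalSubmodule τ))

/-- The norm `‖f‖_τ = ∑ ‖f τ ^ k‖_∞`, summed over `k ≥ 0`. -/
instance : Norm (Segal τ) := ⟨fun f => ∑' k : ℕ, ‖mulCb (τ ^ k) f.1‖⟩

theorem Segal.norm_def (f : Segal τ) : ‖f‖ = ∑' k : ℕ, ‖mulCb (τ ^ k) f.1‖ := rfl

theorem Segal.summable (f : Segal τ) : Summable fun k : ℕ => ‖mulCb (τ ^ k) f.1‖ := f.2

theorem Segal.core : NormedSpace.Core ℂ (Segal τ) where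
  norm_nonneg f := tsum_nonneg fun _ => norm_nonneg _
  norm_smul c f := by
    rw [Segal.norm_def, Segal.norm_def, ← tsum_mul_left]
    refine tsum_congr fun k => ?_
    change ‖mulCb (τ ^ k) (c • f.1)‖ = _
    rw [map_smul, norm_smul]
  norm_triangle f g := by
    rw [Segal.norm_def, Segal.norm_def, Segal.norm_def, ← f.summable.tsum_add g.summable]
    refine (f + g).summable.tsum_le_tsum (fun k => ?_) (f.summable.add g.summable)
    change ‖mulCb (τ ^ k) (f.1 + g.1)‖ ≤ _
    rw [map_add]
    exact norm_add_le _ _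
  norm_eq_zero_iff f := by
    constructor
    · intro h
      have h1 := f.summable.le_tsum 0 fun _ _ => norm_nonneg _
      rw [← Segal.norm_def, h] at h1
      have h2 : mulCb (τ ^ 0) f.1 = f.1 := by ext x; simp
      rw [h2] at h1
      exact Subtype.ext (norm_le_zero_iff.1 h1)
    · rintro rfl
      have h : ∀ k : ℕ, ‖mulCb (τ ^ k) (0 : Segal τ).1‖ = 0 := fun k => by
        change ‖mulCb (τ ^ k) 0‖ = 0
        simp
      simp [Segal.norm_def, h]

instance : NormedAddCommGroup (Segal τ) := NormedAddCommGroup.ofCore Segal.core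
instance : NormedSpace ℂ (Segal τ) := NormedSpace.ofCore Segal.core

/-- `τ ∘ α ^ k`, where `α ^ k` is the `k`-th iterate of `α` (of `α⁻¹` for negative `k`). -/
def iter (τ : ℝ →ᵇ ℂ) (α : ℝ ≃ₜ ℝ) (k : ℤ) : ℝ →ᵇ ℂ :=
  τ.compContinuous ⟨⇑(α ^ k : ℝ ≃ₜ ℝ), (α ^ k : ℝ ≃ₜ ℝ).continuous⟩

theorem norm_mulCb_weightedComp_le (τ : ℝ →ᵇ ℂ) (α : ℝ ≃ₜ ℝ) (w : ℝ →ᵇ ℂ) (j : ℤ) (k : ℕ)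
    (f : C₀(ℝ, ℂ)) :
    ‖mulCb (iter τ α j ^ k) (weightedComp α w f)‖ ≤ ‖w‖ * ‖mulCb (iter τ α (j - 1) ^ k) f‖ := by
  refine norm_le_of_forall (by positivity) fun x => ?_
  have h1 : iter τ α j x = iter τ α (j - 1) (α x) := by
    have h : α ^ j = α ^ (j - 1) * α := by rw [zpow_sub_one, inv_mul_cancel_right]
    change τ ((α ^ j : ℝ ≃ₜ ℝ) x) = τ ((α ^ (j - 1) * α : ℝ ≃ₜ ℝ) x)
    rw [h]
  have h2 : mulCb (iter τ α j ^ k) (weightedComp α w f) x =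
      w x * mulCb (iter τ α (j - 1) ^ k) f (α x) := by
    simp [h1, mul_left_comm]
  rw [h2, norm_mul]
  exact mul_le_mul (w.norm_coe_le_norm x) (norm_apply_le _ _) (norm_nonneg _) (norm_nonneg _)

/-- The map `f ↦ w · (f ∘ α)` from the Segal algebra of `τ ∘ α ^ (j - 1)` to that of `τ ∘ α ^ j`. -/
def segalStep (τ : ℝ →ᵇ ℂ) (α : ℝ ≃ₜ ℝ) (w : ℝ →ᵇ ℂ) (j : ℤ) :
    Segal (iter τ α (j - 1)) →ₗ[ℂ] Segal (iter τ α j) where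
  toFun f := ⟨weightedComp α w f.1,
    Summable.of_nonneg_of_le (fun _ => norm_nonneg _)
      (fun k => norm_mulCb_weightedComp_le τ α w j k f.1) (f.summable.mul_left _)⟩
  map_add' f g := Subtype.ext (map_add (weightedComp α w) f.1 g.1)
  map_smul' c f := Subtype.ext (map_smul (weightedComp α w) c f.1)

theorem norm_segalStep_le (τ : ℝ →ᵇ ℂ) (α : ℝ ≃ₜ ℝ) (w : ℝ →ᵇ ℂ) (j : ℤ)
    (f : Segal (iter τ α (j - 1))) : ‖segalStep τ α w j f‖ ≤ ‖w‖ * ‖f‖ := by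
  rw [Segal.norm_def, Segal.norm_def, ← tsum_mul_left]
  exact (segalStep τ α w j f).summable.tsum_le_tsum
    (fun k => norm_mulCb_weightedComp_le τ α w j k f.1) (f.summable.mul_left _)

/-- The space `c₀^{A,τ}` of sequences `s_k`, `k ∈ ℤ`, in the Segal algebras of `τ ∘ α ^ k` whose norms
tend to `0` as `k → ∞` and as `k → -∞`, with the supremum norm. Such sequences are bounded, so they
form a subspace of the space `lp _ ∞` of all bounded sequences. -/
def C0Segal (τ : ℝ →ᵇ ℂ) (α : ℝ ≃ₜ ℝ) : Submodule ℂ (lp (fun k : ℤ => Segal (iter τ α k)) ∞) where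
  carrier := {s | Tendsto (fun k => ‖s k‖) atTop (𝓝 0) ∧ Tendsto (fun k => ‖s k‖) atBot (𝓝 0)}
  zero_mem' := by simp
  add_mem' := by
    rintro s t ⟨hs, hs'⟩ ⟨ht, ht'⟩
    have hle : ∀ k, ‖(s + t) k‖ ≤ ‖s k‖ + ‖t k‖ := fun k => norm_add_le _ _
    exact ⟨squeeze_zero (fun _ => norm_nonneg _) hle (by simpa using hs.add ht),
      squeeze_zero (fun _ => norm_nonneg _) hle (by simpa using hs'.add ht')⟩
  smul_mem' := by
    rintro c s ⟨hs, hs'⟩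
    have hle : ∀ k, ‖(c • s) k‖ ≤ ‖c‖ * ‖s k‖ := fun k => (norm_smul c (s k)).le
    exact ⟨squeeze_zero (fun _ => norm_nonneg _) hle (by simpa using hs.const_mul ‖c‖),
      squeeze_zero (fun _ => norm_nonneg _) hle (by simpa using hs'.const_mul ‖c‖)⟩

variable (τ) (α : ℝ ≃ₜ ℝ) (W : ℤ → ℝ →ᵇ ℂ)

theorem norm_segalStep_le_sup (hW : BddAbove (Set.range fun j => ‖W j‖))
    (j : ℤ) (f : Segal (iter τ α (j - 1))) :
    ‖segalStep τ α (W j) j f‖ ≤ supNorm W * ‖f‖ :=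
  (norm_segalStep_le τ α (W j) j f).trans
    (mul_le_mul_of_nonneg_right (le_ciSup hW j) (norm_nonneg _))

theorem tendsto_const_mul_shift (C : ℝ) {u : ℤ → ℝ} {l : Filter ℤ} (hu : Tendsto u l (𝓝 0))
    (hl : Tendsto (fun j : ℤ => j - 1) l l) : Tendsto (fun j => C * u (j - 1)) l (𝓝 0) := by
  have h := (hu.comp hl).const_mul C
  rwa [mul_zero] at h

/-- The weighted bilateral shift `(T s)_j = w_j · (s_{j-1} ∘ α)` on `c₀^{A,τ}`. -/
def shiftC0 (hW : BddAbove (Set.range fun j => ‖W j‖)) :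
    C0Segal τ α →L[ℂ] C0Segal τ α :=
  LinearMap.mkContinuous
    { toFun := fun s =>
        ⟨⟨fun j => segalStep τ α (W j) j (s.1 (j - 1)), memℓp_infty
            ⟨supNorm W * ‖s.1‖, by
              rintro _ ⟨j, rfl⟩
              exact (norm_segalStep_le_sup τ α W hW j _).trans (mul_le_mul_of_nonneg_left
                (lp.norm_apply_le_norm ENNReal.top_ne_zero s.1 _) (supNorm_nonneg W))⟩⟩,
          squeeze_zero (fun _ => norm_nonneg _)
            (fun j => norm_segalStep_le_sup τ α W hW j (s.1 (j - 1)))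
            (tendsto_const_mul_shift (supNorm W) s.2.1
              (tendsto_atTop_add_const_right atTop (-1 : ℤ) tendsto_id)),
          squeeze_zero (fun _ => norm_nonneg _)
            (fun j => norm_segalStep_le_sup τ α W hW j (s.1 (j - 1)))
            (tendsto_const_mul_shift (supNorm W) s.2.2
              (tendsto_atBot_add_const_right atBot (-1 : ℤ) tendsto_id))⟩
      map_add' := fun s t => Subtype.ext (lp.ext (funext fun j =>
        map_add (segalStep τ α (W j) j) (s.1 (j - 1)) (t.1 (j - 1))))
      map_smul' := fun c s => Subtype.ext (lp.ext (funext fun j =>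
        map_smul (segalStep τ α (W j) j) c (s.1 (j - 1)))) }
    (supNorm W) (by
      intro s
      refine lp.norm_le_of_forall_le (mul_nonneg (supNorm_nonneg W) (norm_nonneg s)) fun j => ?_
      exact (norm_segalStep_le_sup τ α W hW j _).trans (mul_le_mul_of_nonneg_left
        (lp.norm_apply_le_norm ENNReal.top_ne_zero s.1 _) (supNorm_nonneg W)))

theorem shiftC0_apply (hW : BddAbove (Set.range fun j => ‖W j‖))
    (s : C0Segal τ α) (j : ℤ) :
    ((shiftC0 τ α W hW s).1 j).1 = weightedComp α (W j) (s.1 (j - 1)).1 := rfl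

end Segal

end SegalShift

end

/-! The `n`-th power of the shift sends `a` to the sequence with entries `p_{n,j} · (a_{j-n} ∘ α ^
n)`, where `p_{n,j}` is a product of `n` weights. The same formula holds on both spaces, so the
behaviour of the `p_{n,j}` on compact sets is what carries over. From `ℓ²`: a bump equal to one on a
compact `K`, repeated at the indices `|j| ≤ m`, is close to some `a` with `T ^ n a` also close to
it, for some `n > 2m`. Since `j + n` and `j - n` leave the window, comparing entries makes
`p_{n,j+n} ∘ α ^ (-n)` small on `K` and `p_{n,j}` large on `K` (`exists_iterWeight_small_large`). To
`c₀`: for `f` and `g` of finite index support and compact spatial support, the first estimate makes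
`T ^ n f` small, and the second yields a small exact preimage `u` of `g` under `T ^ n`. Composition
with `α ^ n` also transports the symbols `τ ∘ α ^ j`, so pointwise bounds become bounds of Segal
norms with no loss (`Segal.exists_of_le`, `C0Segal.exists_of_le`). Baire category then gives a dense
orbit (`Hypercyclic.of_dense`). Baire needs a complete separable space. Separability descends from
the dense orbit in `ℓ²` to `C₀(ℝ)`, and reaches `c₀` because the Segal and supremum norms are
equivalent on functions supported where the symbol is at most some `r < 1`; such compactly supported
functions are dense. -/

namespace SegalShift

/-! ### Hypercyclicity on normed spaces -/

/-- A hypercyclicity criterion: density of `D` and approximate right inverses on `D` whose norms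
become small together with the forward orbits. -/
theorem Hypercyclic.of_dense {E : Type*} [NormedAddCommGroup E] [NormedSpace ℂ E]
    [CompleteSpace E] [TopologicalSpace.SeparableSpace E] (T : E →L[ℂ] E) {D : Set E}
    (hD : Dense D)
    (h : ∀ f ∈ D, ∀ g ∈ D, ∀ ε > 0, ∃ (n : ℕ) (u : E), ‖(T ^ n) f‖ < ε ∧ ‖u‖ < ε ∧ (T ^ n) u = g) :
    Hypercyclic T := by
  have : SecondCountableTopology E := UniformSpace.secondCountable_of_separable E
  let B := TopologicalSpace.countableBasis E
  -- Baire category: a point of this countable intersection has an orbit that meets every basic open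
  -- set.
  have key : Dense (⋂ s ∈ B, ⋃ n : ℕ, (T ^ n) ⁻¹' s) := by
    refine dense_biInter_of_isOpen (fun s hs => isOpen_iUnion fun n =>
      (TopologicalSpace.isOpen_of_mem_countableBasis hs).preimage (T ^ n).continuous)
      (TopologicalSpace.countable_countableBasis E) fun s hs => ?_
    refine dense_iff_inter_open.2 fun V hV hVne => ?_
    obtain ⟨f, hfV, hfD⟩ := hD.inter_open_nonempty V hV hVne
    have hso := TopologicalSpace.isOpen_of_mem_countableBasis hs
    obtain ⟨g, hgs, hgD⟩ := hD.inter_open_nonempty s hso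
      (TopologicalSpace.nonempty_of_mem_countableBasis hs)
    obtain ⟨ε, hε, hεV⟩ := Metric.isOpen_iff.1 hV f hfV
    obtain ⟨δ, hδ, hδs⟩ := Metric.isOpen_iff.1 hso g hgs
    obtain ⟨n, u, h1, h2, h3⟩ := h f hfD g hgD (min ε δ) (lt_min hε hδ)
    -- The perturbation `f + u` stays near `f`, while its image `T ^ n f + g` is near `g`.
    refine ⟨f + u, hεV ?_, Set.mem_iUnion.2 ⟨n, hδs ?_⟩⟩
    · simpa using h2.trans_le (min_le_left _ _)
    · rw [map_add, h3]
      simpa using h1.trans_le (min_le_right _ _)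
  obtain ⟨x, hx⟩ := key.nonempty
  refine ⟨x, (TopologicalSpace.isBasis_countableBasis E).dense_iff.2 fun s hs _ => ?_⟩
  obtain ⟨n, hn⟩ := Set.mem_iUnion.1 (Set.mem_iInter₂.1 hx s hs)
  exact ⟨_, hn, n, rfl⟩

/-- Any two vectors are approximated by a vector and one of its later iterates. -/
theorem Hypercyclic.exists_near {E : Type*} [NormedAddCommGroup E] [NormedSpace ℂ E] [Nontrivial E]
    {T : E →L[ℂ] E} (hT : Hypercyclic T) (f g : E) {ε : ℝ} (hε : 0 < ε) (N : ℕ) :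
    ∃ n ≥ N, ∃ x, ‖x - f‖ < ε ∧ ‖(T ^ n) x - g‖ < ε := by
  obtain ⟨x, hx⟩ := hT
  classical
  obtain ⟨_, hp, p, rfl⟩ := Metric.dense_iff.1 hx f ε hε
  -- Without isolated points, a dense orbit stays dense after finitely many points are removed; this
  -- forces the second visit to come at least `N` steps after the first.
  have : ∀ y : E, (𝓝[≠] y).NeBot := fun y => Module.punctured_nhds_neBot ℂ E y
  have hx' := hx.sdiff_finset ((Finset.range (p + N)).image fun n => (T ^ n) x)
  obtain ⟨_, hq, ⟨q, rfl⟩, hq'⟩ := Metric.dense_iff.1 hx' g ε hε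
  have hle : p + N ≤ q := by
    by_contra! hlt
    exact hq' (Finset.mem_coe.2 (Finset.mem_image.2 ⟨q, Finset.mem_range.2 hlt, rfl⟩))
  refine ⟨q - p, by omega, (T ^ p) x, mem_ball_iff_norm.1 hp, ?_⟩
  have : (T ^ (q - p)) ((T ^ p) x) = (T ^ q) x := by
    rw [← mul_apply_eq_comp, ← pow_add, Nat.sub_add_cancel (by omega)]
  rw [this]
  exact mem_ball_iff_norm.1 hq

/-! ### Coordinates of the Hilbert module and separability -/

section HilbertModule

variable {A : Type*} [NonUnitalCommCStarAlgebra A]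

/-- In the spectral order all terms `a_j⋆ a_j` are nonnegative, so each is dominated by the sum, and
the norm is monotone on positive elements. -/
theorem L2.norm_apply_le_norm (a : L2 A) (j : ℤ) : ‖a.1 j‖ ≤ ‖a‖ := by
  let _ := CStarAlgebra.spectralOrder A
  let _ := CStarAlgebra.spectralOrderedRing A
  have ha : Summable fun j => star (a.1 j) * a.1 j := a.2
  have h3 : ‖star (a.1 j) * a.1 j‖ ≤ ‖∑' j, star (a.1 j) * a.1 j‖ := by
    refine ge_of_tendsto ha.hasSum.norm ?_
    filter_upwards [eventually_ge_atTop {j}] with s hs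
    refine CStarAlgebra.norm_le_norm_of_nonneg_of_le (star_mul_self_nonneg _) ?_
    exact Finset.single_le_sum (f := fun j => star (a.1 j) * a.1 j)
      (fun i _ => star_mul_self_nonneg _) (hs (Finset.mem_singleton_self j))
  rw [CStarRing.norm_star_mul_self] at h3
  exact Real.le_sqrt_of_sq_le (by rwa [sq])

theorem L2.norm_apply_sub_le (a b : L2 A) (j : ℤ) : ‖a.1 j - b.1 j‖ ≤ ‖a - b‖ :=
  L2.norm_apply_le_norm (a - b) j

/-- The finitely supported sequence with the value `f` on `s`. -/
def L2.const (s : Finset ℤ) (f : A) : L2 A :=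
  ⟨fun j => if j ∈ s then f else 0, summable_of_ne_finset_zero (s := s) fun j hj => by simp [hj]⟩

theorem L2.const_of_mem {s : Finset ℤ} (f : A) {j : ℤ} (hj : j ∈ s) :
    (L2.const s f).1 j = f := if_pos hj

theorem L2.const_of_notMem {s : Finset ℤ} (f : A) {j : ℤ} (hj : j ∉ s) :
    (L2.const s f).1 j = 0 := if_neg hj

instance [Nontrivial A] : Nontrivial (L2 A) := by
  obtain ⟨f, hf⟩ := exists_ne (0 : A)
  refine ⟨L2.const {0} f, 0, fun h => hf ?_⟩
  rw [← L2.const_of_mem f (Finset.mem_singleton_self (0 : ℤ)), h]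
  rfl

theorem L2.separableSpace_of_separableSpace [TopologicalSpace.SeparableSpace (L2 A)] :
    TopologicalSpace.SeparableSpace A := by
  have hc : Continuous fun a : L2 A => a.1 0 :=
    (LipschitzWith.of_dist_le_mul (K := 1) fun a b => by
      rw [NNReal.coe_one, one_mul, dist_eq_norm, dist_eq_norm]
      exact L2.norm_apply_sub_le a b 0).continuous
  have hs : Function.Surjective fun a : L2 A => a.1 0 := fun f =>
    ⟨L2.const {0} f, L2.const_of_mem f (Finset.mem_singleton_self 0)⟩
  exact hs.denseRange.separableSpace hc

end HilbertModule

theorem Hypercyclic.separableSpace {E : Type*} [NormedAddCommGroup E] [NormedSpace ℂ E]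
    {T : E →L[ℂ] E} (hT : Hypercyclic T) : TopologicalSpace.SeparableSpace E := by
  obtain ⟨x, hx⟩ := hT
  exact ⟨_, Set.countable_range _, hx⟩

/-! ### Iterated weights and what hypercyclicity on `ℓ²` forces on them -/

/-- A function in `C₀(ℝ)` that equals one on a given compact set. -/
theorem exists_eqOn_one_of_isCompact {K : Set ℝ} (hK : IsCompact K) :
    ∃ e : C₀(ℝ, ℂ), ∀ x ∈ K, e x = 1 := by
  obtain ⟨f, h1, -, hc, -⟩ := exists_continuous_one_zero_of_isCompact hK isClosed_empty
    (Set.disjoint_empty K)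
  refine ⟨⟨⟨fun x => (f x : ℂ), by fun_prop⟩, ?_⟩, fun x hx => ?_⟩
  · exact (hc.comp_left (g := ((↑) : ℝ → ℂ)) Complex.ofReal_zero).is_zero_at_infty
  · change ((f x : ℝ) : ℂ) = 1
    simp [h1 hx]

instance : Nontrivial C₀(ℝ, ℂ) := by
  obtain ⟨e, he⟩ := exists_eqOn_one_of_isCompact (isCompact_singleton (x := (0 : ℝ)))
  refine ⟨e, 0, fun h => ?_⟩
  have := he 0 rfl
  simp [h] at this

variable (α : ℝ ≃ₜ ℝ) (W : ℤ → ℝ →ᵇ ℂ)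

/-- The weight `w_j · (w_{j-1} ∘ α) ⋯ (w_{j-n+1} ∘ α ^ (n - 1))` of the `n`-th power of the shift. -/
noncomputable def iterWeight : ℕ → ℤ → ℝ →ᵇ ℂ
  | 0, _ => 1
  | n + 1, j => W j * (iterWeight n (j - 1)).compContinuous ⟨α, α.continuous⟩

theorem iterWeight_succ_apply (n : ℕ) (j : ℤ) (x : ℝ) :
    iterWeight α W (n + 1) j x = W j x * iterWeight α W n (j - 1) (α x) := rfl

/-- Iterates of the recursion `a_j ↦ w_j · (a_{j-1} ∘ α)`. -/
theorem iterate_eq_iterWeight_mul {a : ℕ → ℤ → ℝ → ℂ}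
    (h : ∀ n j x, a (n + 1) j x = W j x * a n (j - 1) (α x)) (n : ℕ) (j : ℤ) (x : ℝ) :
    a n j x = iterWeight α W n j x * a 0 (j - n) ((α ^ (n : ℤ) : ℝ ≃ₜ ℝ) x) := by
  induction n generalizing j x with
  | zero => simp [iterWeight]
  | succ n ih =>
    rw [h, ih, iterWeight_succ_apply, mul_assoc]
    have h1 : j - 1 - (n : ℤ) = j - ((n + 1 : ℕ) : ℤ) := by push_cast; ring
    have h2 : (α ^ ((n + 1 : ℕ) : ℤ) : ℝ ≃ₜ ℝ) x = (α ^ (n : ℤ) : ℝ ≃ₜ ℝ) (α x) := by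
      rw [Nat.cast_succ, zpow_add_one]
      rfl
    rw [h1, h2]

variable {W}

theorem shiftL2_pow_apply (hW : BddAbove (Set.range fun j => ‖W j‖)) (n : ℕ) (a : L2 C₀(ℝ, ℂ))
    (j : ℤ) (x : ℝ) : ((shiftL2 α W hW ^ n) a).1 j x =
      iterWeight α W n j x * a.1 (j - n) ((α ^ (n : ℤ) : ℝ ≃ₜ ℝ) x) := by
  refine iterate_eq_iterWeight_mul α W (a := fun n j x => ((shiftL2 α W hW ^ n) a).1 j x)
    (fun n j x => ?_) n j x
  simp only [pow_succ', mul_apply_eq_comp]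
  rw [shiftL2_apply, weightedComp_apply]

theorem shiftC0_pow_apply (τ : ℝ →ᵇ ℂ) (hW : BddAbove (Set.range fun j => ‖W j‖)) (n : ℕ)
    (s : C0Segal τ α) (j : ℤ) (x : ℝ) : (((shiftC0 τ α W hW ^ n) s).1 j).1 x =
      iterWeight α W n j x * (s.1 (j - n)).1 ((α ^ (n : ℤ) : ℝ ≃ₜ ℝ) x) := by
  refine iterate_eq_iterWeight_mul α W (a := fun n j x => (((shiftC0 τ α W hW ^ n) s).1 j).1 x)
    (fun n j x => ?_) n j x
  simp only [pow_succ', mul_apply_eq_comp]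
  rw [shiftC0_apply, weightedComp_apply]

theorem zpow_neg_zpow_apply (n : ℤ) (x : ℝ) :
    (α ^ (-n) : ℝ ≃ₜ ℝ) ((α ^ n : ℝ ≃ₜ ℝ) x) = x := by
  change (α ^ (-n) * α ^ n : ℝ ≃ₜ ℝ) x = x
  rw [← zpow_add, neg_add_cancel, zpow_zero]
  rfl

theorem zpow_zpow_neg_apply (n : ℤ) (x : ℝ) :
    (α ^ n : ℝ ≃ₜ ℝ) ((α ^ (-n) : ℝ ≃ₜ ℝ) x) = x := by
  have := zpow_neg_zpow_apply α (-n) x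
  rwa [neg_neg] at this

/-- Hypercyclicity on `ℓ²(C₀(ℝ))` makes the forward weights small and the backward weights large
on compact sets. -/
theorem exists_iterWeight_small_large (hW : BddAbove (Set.range fun j => ‖W j‖))
    (h : Hypercyclic (shiftL2 α W hW)) {K : Set ℝ} (hK : IsCompact K) (m : ℕ) {ε : ℝ}
    (hε : 0 < ε) :
    ∃ n : ℕ, ∀ j : ℤ, |j| ≤ m → ∀ y ∈ K,
      ‖iterWeight α W n (j + n) ((α ^ (-(n : ℤ)) : ℝ ≃ₜ ℝ) y)‖ ≤ ε ∧
        ε⁻¹ ≤ ‖iterWeight α W n j y‖ := by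
  -- With `ε ≤ 1`, an error below `ε / 2` leaves modulus at least `1 / 2` where the bump equals one.
  wlog hε1 : ε ≤ 1 generalizing ε
  · obtain ⟨n, hn⟩ := this one_pos le_rfl
    refine ⟨n, fun j hj y hy => ⟨(hn j hj y hy).1.trans (le_of_not_ge hε1), ?_⟩⟩
    refine le_trans ?_ (hn j hj y hy).2
    rw [inv_one]
    exact inv_le_one_of_one_le₀ (le_of_not_ge hε1)
  obtain ⟨e, he⟩ := exists_eqOn_one_of_isCompact hK
  let g := L2.const (Finset.Icc (-m : ℤ) m) e
  -- A shift by `n ≥ 2m + 1` moves the window `[-m, m]` off itself in either direction.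
  obtain ⟨n, hn, a, ha, ha'⟩ := h.exists_near g g (half_pos hε) (2 * m + 1)
  have near : ∀ {b : L2 C₀(ℝ, ℂ)}, ‖b - g‖ < ε / 2 → ∀ j x, ‖b.1 j x - g.1 j x‖ < ε / 2 :=
    fun hb j x => ((norm_apply_le _ x).trans (L2.norm_apply_sub_le _ g j)).trans_lt hb
  have large : ∀ {b : L2 C₀(ℝ, ℂ)}, ‖b - g‖ < ε / 2 → ∀ j : ℤ, |j| ≤ m → ∀ y ∈ K,
      1 / 2 ≤ ‖b.1 j y‖ := by
    intro b hb j hj y hy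
    have h1 := near hb j y
    have hg : g.1 j = e := L2.const_of_mem e (Finset.mem_Icc.2 (abs_le.1 hj))
    rw [hg, he y hy] at h1
    have h2 := norm_sub_norm_le (1 : ℂ) (b.1 j y)
    rw [norm_one, norm_sub_rev] at h2
    linarith
  have small : ∀ {b : L2 C₀(ℝ, ℂ)}, ‖b - g‖ < ε / 2 → ∀ j : ℤ, ¬ |j| ≤ m → ∀ y,
      ‖b.1 j y‖ < ε / 2 := by
    intro b hb j hj y
    have hg : g.1 j = 0 := L2.const_of_notMem e fun h' => hj (abs_le.2 (Finset.mem_Icc.1 h'))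
    simpa [hg] using near hb j y
  refine ⟨n, fun j hj y hy => ⟨?_, ?_⟩⟩
  -- Outside the window `T ^ n a` is below `ε / 2`. Its entry at `j + n` is the weight times `a_j
  -- y`, and `|a_j y| ≥ 1 / 2`.
  · have h1 := small ha' (j + n) (by have := abs_le.1 hj; rw [abs_le]; omega)
      ((α ^ (-(n : ℤ)) : ℝ ≃ₜ ℝ) y)
    rw [shiftL2_pow_apply, zpow_zpow_neg_apply, add_sub_cancel_right, norm_mul] at h1
    nlinarith [large ha j hj y hy,
      norm_nonneg (iterWeight α W n (j + n) ((α ^ (-(n : ℤ)) : ℝ ≃ₜ ℝ) y))]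
  -- Here the product of the weight and an entry of `a` outside the window has modulus at least `1 /
  -- 2`, while that entry is below `ε / 2`.
  · have h1 := large ha' j hj y hy
    rw [shiftL2_pow_apply, norm_mul] at h1
    have h2 := small ha (j - n) (by have := abs_le.1 hj; rw [abs_le]; omega)
      ((α ^ (n : ℤ) : ℝ ≃ₜ ℝ) y)
    rw [inv_le_iff_one_le_mul₀ hε]
    nlinarith [norm_nonneg (iterWeight α W n j y)]

end SegalShift

/-! ### Segal algebras: norm comparison, completeness, approximation by compact supports -/

namespace SegalShift

theorem norm_mulCb_le (w : ℝ →ᵇ ℂ) (f : C₀(ℝ, ℂ)) : ‖mulCb w f‖ ≤ ‖w‖ * ‖f‖ :=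
  norm_le_of_forall (by positivity) fun x => by
    rw [mulCb_apply, norm_mul]
    exact mul_le_mul (w.norm_coe_le_norm x) (norm_apply_le f x) (norm_nonneg _) (norm_nonneg _)

theorem continuous_mulCb (w : ℝ →ᵇ ℂ) : Continuous (mulCb w) :=
  AddMonoidHomClass.continuous_of_bound (mulCb w) ‖w‖ (norm_mulCb_le w)

section Segal

variable {σ ρ : ℝ →ᵇ ℂ}

/-- The element of the Segal algebra given by a function with summable norms. -/
def Segal.mk (f : C₀(ℝ, ℂ)) (hf : Summable fun k : ℕ => ‖mulCb (σ ^ k) f‖) : Segal σ := ⟨f, hf⟩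

theorem Segal.norm_coe_le_norm (f : Segal σ) : ‖f.1‖ ≤ ‖f‖ := by
  have h1 := f.summable.le_tsum 0 fun _ _ => norm_nonneg _
  have h2 : mulCb (σ ^ 0) f.1 = f.1 := by ext x; simp
  rwa [h2] at h1

theorem Segal.norm_coe_sub_le (f g : Segal σ) : ‖f.1 - g.1‖ ≤ ‖f - g‖ :=
  Segal.norm_coe_le_norm (f - g)

/-- A function in `C₀(ℝ)` dominated by a composition of an element of a Segal algebra belongs to
the Segal algebra of the composed symbol. -/
theorem Segal.exists_of_le (f : Segal σ) (g : C₀(ℝ, ℂ)) (β : ℝ → ℝ) {ε : ℝ} (hε : 0 ≤ ε)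
    (hρ : ∀ x, ρ x = σ (β x)) (h : ∀ x, ‖g x‖ ≤ ε * ‖f.1 (β x)‖) :
    ∃ u : Segal ρ, u.1 = g ∧ ‖u‖ ≤ ε * ‖f‖ := by
  have hle : ∀ k : ℕ, ‖mulCb (ρ ^ k) g‖ ≤ ε * ‖mulCb (σ ^ k) f.1‖ := fun k => by
    refine norm_le_of_forall (by positivity) fun x => ?_
    calc ‖mulCb (ρ ^ k) g x‖ = ‖σ (β x) ^ k‖ * ‖g x‖ := by simp [hρ]
      _ ≤ ‖σ (β x) ^ k‖ * (ε * ‖f.1 (β x)‖) := by gcongr; exact h x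
      _ = ε * ‖mulCb (σ ^ k) f.1 (β x)‖ := by simp [mul_left_comm]
      _ ≤ ε * ‖mulCb (σ ^ k) f.1‖ := by gcongr; exact norm_apply_le _ _
  have hs : Summable fun k : ℕ => ‖mulCb (ρ ^ k) g‖ :=
    .of_nonneg_of_le (fun _ => norm_nonneg _) hle (f.summable.mul_left ε)
  refine ⟨Segal.mk g hs, rfl, ?_⟩
  rw [Segal.norm_def, Segal.norm_def, ← tsum_mul_left]
  exact hs.tsum_le_tsum hle (f.summable.mul_left ε)

/-- Where the symbol is at most `r < 1`, the Segal norm is controlled by the supremum norm. -/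
theorem Segal.norm_le_of_symbol_le (f : Segal σ) {r : ℝ} (hr0 : 0 ≤ r) (hr : r < 1)
    (h : ∀ x, f.1 x ≠ 0 → ‖σ x‖ ≤ r) : ‖f‖ ≤ (1 - r)⁻¹ * ‖f.1‖ := by
  rw [Segal.norm_def, ← tsum_geometric_of_lt_one hr0 hr, ← tsum_mul_right]
  refine f.summable.tsum_le_tsum (fun k => ?_)
    ((summable_geometric_of_lt_one hr0 hr).mul_right _)
  refine norm_le_of_forall (by positivity) fun x => ?_
  by_cases hx : f.1 x = 0
  · simp only [mulCb_apply, hx, mul_zero, norm_zero]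
    positivity
  · rw [mulCb_apply, norm_mul, BoundedContinuousFunction.coe_pow, Pi.pow_apply, norm_pow]
    gcongr
    · exact h x hx
    · exact norm_apply_le _ _

/-- At such a point the series of norms dominates a nonzero multiple of the geometric series in `‖σ
x‖`. -/
theorem Segal.norm_symbol_lt_one (f : Segal σ) {x : ℝ} (hx : f.1 x ≠ 0) : ‖σ x‖ < 1 := by
  have h : Summable fun k : ℕ => ‖f.1 x‖⁻¹ * ‖mulCb (σ ^ k) f.1‖ := f.summable.mul_left _
  have h2 : Summable fun k : ℕ => ‖σ x‖ ^ k := by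
    refine .of_nonneg_of_le (fun _ => by positivity) (fun k => ?_) h
    rw [← div_eq_inv_mul, le_div_iff₀ (norm_pos_iff.2 hx)]
    simpa using norm_apply_le (mulCb (σ ^ k) f.1) x
  simpa using summable_geometric_iff_norm_lt_one.1 h2

/-- The term `k = 0` of the norm is the supremum norm, so a Cauchy sequence has a uniform limit.
Bounds on finite partial sums survive this limit, giving both membership and convergence in the
Segal norm. -/
instance : CompleteSpace (Segal σ) := by
  refine Metric.complete_of_cauchySeq_tendsto fun u hu => ?_
  have hu0 : CauchySeq fun n => (u n).1 := by
    rw [Metric.cauchySeq_iff'] at hu ⊢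
    intro ε hε
    obtain ⟨N, hN⟩ := hu ε hε
    refine ⟨N, fun n hn => lt_of_le_of_lt ?_ (hN n hn)⟩
    rw [dist_eq_norm, dist_eq_norm]
    exact Segal.norm_coe_sub_le _ _
  obtain ⟨f, hf⟩ := cauchySeq_tendsto_of_complete hu0
  have key : ∀ ε > 0, ∃ N, ∀ n ≥ N, ∀ s : Finset ℕ,
      ∑ k ∈ s, ‖mulCb (σ ^ k) ((u n).1 - f)‖ ≤ ε := by
    intro ε hε
    obtain ⟨N, hN⟩ := Metric.cauchySeq_iff.1 hu ε hε
    refine ⟨N, fun n hn s => ?_⟩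
    have hlim : Tendsto (fun p => ∑ k ∈ s, ‖mulCb (σ ^ k) ((u n).1 - (u p).1)‖) atTop
        (𝓝 (∑ k ∈ s, ‖mulCb (σ ^ k) ((u n).1 - f)‖)) :=
      tendsto_finsetSum _ fun k _ =>
        (((continuous_mulCb (σ ^ k)).tendsto _).comp (hf.const_sub _)).norm
    refine le_of_tendsto hlim ?_
    filter_upwards [eventually_ge_atTop N] with p hp
    refine ((u n - u p).summable.sum_le_tsum s fun _ _ => norm_nonneg _).trans ?_
    rw [← Segal.norm_def, ← dist_eq_norm]
    exact (hN n hn p hp).le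
  have hmem : ∀ n, ∀ ε, (∀ s : Finset ℕ, ∑ k ∈ s, ‖mulCb (σ ^ k) ((u n).1 - f)‖ ≤ ε) →
      (u n).1 - f ∈ segalSubmodule σ := fun n ε h =>
    summable_of_sum_le (fun _ => norm_nonneg _) h
  have hfm : f ∈ segalSubmodule σ := by
    obtain ⟨N, hN⟩ := key 1 one_pos
    have := (segalSubmodule σ).sub_mem (u N).2 (hmem N 1 (hN N le_rfl))
    rwa [sub_sub_cancel] at this
  refine ⟨Segal.mk f hfm, Metric.tendsto_atTop.2 fun ε hε => ?_⟩
  obtain ⟨N, hN⟩ := key (ε / 2) (half_pos hε)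
  refine ⟨N, fun n hn => ?_⟩
  rw [dist_eq_norm, Segal.norm_def]
  exact (Real.tsum_le_of_sum_le (fun _ => norm_nonneg _) (hN n hn)).trans_lt (half_lt_self hε)

/-- The cut-off `clamp (n |f| - 1)` between zero and one. -/
noncomputable def cutoff (f : C₀(ℝ, ℂ)) (n : ℕ) : ℝ →ᵇ ℂ :=
  BoundedContinuousFunction.ofNormedAddCommGroup
    (fun x => ((max 0 (min 1 (n * ‖f x‖ - 1)) : ℝ) : ℂ)) (by fun_prop) 1 fun x => by
      rw [Complex.norm_real, Real.norm_of_nonneg (le_max_left _ _)]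
      exact max_le zero_le_one (min_le_left _ _)

theorem cutoff_apply (f : C₀(ℝ, ℂ)) (n : ℕ) (x : ℝ) :
    cutoff f n x = ((max 0 (min 1 (n * ‖f x‖ - 1)) : ℝ) : ℂ) := rfl

theorem norm_mulCb_cutoff_le (f : C₀(ℝ, ℂ)) (n : ℕ) (x : ℝ) :
    ‖mulCb (cutoff f n) f x‖ ≤ ‖f x‖ := by
  rw [mulCb_apply, norm_mul, cutoff_apply, Complex.norm_real,
    Real.norm_of_nonneg (le_max_left _ _)]
  exact mul_le_of_le_one_left (norm_nonneg _) (max_le zero_le_one (min_le_left _ _))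

theorem norm_sub_mulCb_cutoff_apply (f : C₀(ℝ, ℂ)) (n : ℕ) (x : ℝ) :
    ‖f x - mulCb (cutoff f n) f x‖ = (1 - max 0 (min 1 (n * ‖f x‖ - 1))) * ‖f x‖ := by
  rw [mulCb_apply, ← one_sub_mul, norm_mul, cutoff_apply, ← Complex.ofReal_one,
    ← Complex.ofReal_sub, Complex.norm_real, Real.norm_of_nonneg]
  exact sub_nonneg.2 (max_le zero_le_one (min_le_left _ _))

theorem norm_sub_mulCb_cutoff_apply_le (f : C₀(ℝ, ℂ)) (n : ℕ) (x : ℝ) :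
    ‖f x - mulCb (cutoff f n) f x‖ ≤ ‖f x‖ := by
  rw [norm_sub_mulCb_cutoff_apply]
  exact mul_le_of_le_one_left (norm_nonneg _) (sub_le_self _ (le_max_left _ _))

/-- The cut-off equals one where `|f| ≥ 2 / n`; elsewhere the error is at most `|f|` itself. -/
theorem norm_sub_mulCb_cutoff_le (f : C₀(ℝ, ℂ)) {n : ℕ} (hn : 0 < n) :
    ‖f - mulCb (cutoff f n) f‖ ≤ 2 / n := by
  have hn' : (0 : ℝ) < n := Nat.cast_pos.2 hn
  refine norm_le_of_forall (by positivity) fun x => ?_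
  rw [ZeroAtInftyContinuousMap.sub_apply]
  rcases le_total (2 / n : ℝ) ‖f x‖ with h | h
  · rw [div_le_iff₀' hn'] at h
    rw [norm_sub_mulCb_cutoff_apply, min_eq_left (by linarith), max_eq_right zero_le_one, sub_self, zero_mul]
    positivity
  · exact (norm_sub_mulCb_cutoff_apply_le f n x).trans h

theorem one_le_of_mulCb_cutoff_ne_zero {f : C₀(ℝ, ℂ)} {n : ℕ} {x : ℝ}
    (h : mulCb (cutoff f n) f x ≠ 0) : 1 ≤ n * ‖f x‖ := by
  by_contra! hlt
  refine h ?_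
  rw [mulCb_apply, cutoff_apply,
    max_eq_left ((min_le_right _ _).trans (sub_nonpos.2 hlt.le))]
  simp

theorem isCompact_setOf_le_norm (f : C₀(ℝ, ℂ)) {δ : ℝ} (hδ : 0 < δ) :
    IsCompact {x | δ ≤ ‖f x‖} := by
  have hf : Tendsto f (cocompact ℝ) (𝓝 0) := f.zero_at_infty'
  have h : ∀ᶠ x in cocompact ℝ, ‖f x‖ < δ := hf.norm.eventually_lt_const (by simpa)
  obtain ⟨t, ht, hts⟩ := mem_cocompact.1 h
  refine ht.of_isClosed_subset (isClosed_le continuous_const (by fun_prop)) fun x hx => ?_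
  by_contra hxt
  have hlt : ‖f x‖ < δ := hts hxt
  exact hlt.not_ge hx

/-- Functions vanishing off compact sets on which the symbol is bounded by some `r < 1` are dense
in the Segal algebra. -/
theorem Segal.exists_near_compact (f : Segal σ) {ε : ℝ} (hε : 0 < ε) :
    ∃ g : Segal σ, ‖f - g‖ < ε ∧ ∃ K : Set ℝ, IsCompact K ∧ ∃ r < 1,
      ∀ x, g.1 x ≠ 0 → x ∈ K ∧ ‖σ x‖ ≤ r := by
  have hex : ∀ n : ℕ, ∃ g : Segal σ, g.1 = mulCb (cutoff f.1 n) f.1 := fun n => by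
    obtain ⟨u, hu, -⟩ := f.exists_of_le (ρ := σ) (mulCb (cutoff f.1 n) f.1) id zero_le_one
      (fun _ => rfl) fun x => by simpa only [one_mul, id] using norm_mulCb_cutoff_le f.1 n x
    exact ⟨u, hu⟩
  choose g hg using hex
  have hlim : Tendsto (fun n => ‖f - g n‖) atTop (𝓝 0) := by
    -- Each term tends to zero by uniform convergence of the cut-offs, and the summable series of
    -- `f` itself dominates.
    have h := tendsto_tsum_of_dominated_convergence (𝓕 := atTop)
      (f := fun n k => ‖mulCb (σ ^ k) (f.1 - (g n).1)‖) (g := fun _ : ℕ => (0 : ℝ))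
      f.summable (fun k => ?_) (.of_forall fun n k => ?_)
    · rw [tsum_zero] at h
      exact h
    · have h0 : Tendsto (fun n : ℕ => ‖σ ^ k‖ * (2 / n)) atTop (𝓝 0) := by
        simpa using (tendsto_const_div_atTop_nhds_zero_nat (2 : ℝ)).const_mul ‖σ ^ k‖
      refine squeeze_zero' (.of_forall fun _ => norm_nonneg _) ?_ h0
      filter_upwards [eventually_gt_atTop 0] with n hn
      refine (norm_mulCb_le _ _).trans ?_
      gcongr
      rw [hg]
      exact norm_sub_mulCb_cutoff_le f.1 hn
    · rw [norm_norm]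
      refine norm_le_of_forall (norm_nonneg _) fun x => ?_
      refine le_trans ?_ (norm_apply_le _ x)
      rw [mulCb_apply, mulCb_apply, norm_mul, norm_mul, hg]
      gcongr
      exact norm_sub_mulCb_cutoff_apply_le f.1 n x
  obtain ⟨n, hn0, hn⟩ := ((eventually_gt_atTop 0).and (hlim.eventually_lt_const hε)).exists
  have hn' : (0 : ℝ) < n := Nat.cast_pos.2 hn0
  refine ⟨g n, hn, {x | (n : ℝ)⁻¹ ≤ ‖f.1 x‖}, isCompact_setOf_le_norm _ (by positivity), ?_⟩
  have hK := isCompact_setOf_le_norm f.1 (inv_pos.2 hn')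
  have hsub : ∀ x, (g n).1 x ≠ 0 → (n : ℝ)⁻¹ ≤ ‖f.1 x‖ := fun x hx => by
    rw [hg] at hx
    rw [inv_le_iff_one_le_mul₀' hn']
    exact one_le_of_mulCb_cutoff_ne_zero hx
  rcases {x | (n : ℝ)⁻¹ ≤ ‖f.1 x‖}.eq_empty_or_nonempty with he | hne
  · refine ⟨0, one_pos, fun x hx => ?_⟩
    have : x ∈ {x | (n : ℝ)⁻¹ ≤ ‖f.1 x‖} := hsub x hx
    simp [he] at this
  -- The maximum of `|σ|` on the compact set is attained at a point where `f ≠ 0`, hence is below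
  -- one.
  · obtain ⟨y, hy, hmax⟩ := hK.exists_isMaxOn hne
      (f := fun x => ‖σ x‖) (by fun_prop)
    refine ⟨‖σ y‖, f.norm_symbol_lt_one ?_, fun x hx => ⟨hsub x hx, hmax (hsub x hx)⟩⟩
    exact norm_pos_iff.1 ((inv_pos.2 hn').trans_le hy)

end Segal

end SegalShift

/-! ### The space `c₀`: completeness, a dense set, separability -/

namespace SegalShift

variable {τ : ℝ →ᵇ ℂ} {α : ℝ ≃ₜ ℝ}

theorem iter_apply_zpow (τ : ℝ →ᵇ ℂ) (α : ℝ ≃ₜ ℝ) (i m : ℤ) (x : ℝ) :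
    iter τ α (i + m) ((α ^ (-m) : ℝ ≃ₜ ℝ) x) = iter τ α i x := by
  change τ ((α ^ (i + m) * α ^ (-m) : ℝ ≃ₜ ℝ) x) = τ ((α ^ i : ℝ ≃ₜ ℝ) x)
  rw [← zpow_add, add_neg_cancel_right]

theorem C0Segal.norm_apply_le_norm (s : C0Segal τ α) (j : ℤ) : ‖s.1 j‖ ≤ ‖s‖ :=
  lp.norm_apply_le_norm ENNReal.top_ne_zero s.1 j

theorem C0Segal.norm_le {s : C0Segal τ α} {C : ℝ} (hC : 0 ≤ C) (h : ∀ j, ‖s.1 j‖ ≤ C) : ‖s‖ ≤ C :=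
  lp.norm_le_of_forall_le hC h

/-- A family of functions dominated by a translate of an element of `c₀^{A,τ}` is in `c₀^{A,τ}`. -/
theorem C0Segal.exists_of_le (s : C0Segal τ α) (g : ℤ → C₀(ℝ, ℂ)) (m : ℤ) {ε : ℝ} (hε : 0 ≤ ε)
    (h : ∀ i x, ‖g i x‖ ≤ ε * ‖(s.1 (i + m)).1 ((α ^ (-m) : ℝ ≃ₜ ℝ) x)‖) :
    ∃ u : C0Segal τ α, (∀ i, (u.1 i).1 = g i) ∧ ‖u‖ ≤ ε * ‖s‖ := by
  have hex : ∀ i, ∃ u : Segal (iter τ α i), u.1 = g i ∧ ‖u‖ ≤ ε * ‖s.1 (i + m)‖ := fun i =>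
    (s.1 (i + m)).exists_of_le (g i) _ hε (fun x => (iter_apply_zpow τ α i m x).symm) (h i)
  choose u hu hle using hex
  have hle' : ∀ i, ‖u i‖ ≤ ε * ‖s‖ := fun i =>
    (hle i).trans (mul_le_mul_of_nonneg_left (C0Segal.norm_apply_le_norm s _) hε)
  have hlim : ∀ {l : Filter ℤ}, Tendsto (fun k => ‖s.1 k‖) l (𝓝 0) →
      Tendsto (fun i : ℤ => i + m) l l → Tendsto (fun i => ‖u i‖) l (𝓝 0) := fun hs hl =>
    squeeze_zero (fun _ => norm_nonneg _) hle (by simpa using (hs.comp hl).const_mul ε)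
  exact ⟨⟨⟨u, memℓp_infty ⟨ε * ‖s‖, by rintro _ ⟨i, rfl⟩; exact hle' i⟩⟩,
    hlim s.2.1 (tendsto_atTop_add_const_right _ m tendsto_id),
    hlim s.2.2 (tendsto_atBot_add_const_right _ m tendsto_id)⟩, hu,
    C0Segal.norm_le (by positivity) hle'⟩

/-- Finitely supported sequences belong to `c₀^{A,τ}`. -/
theorem C0Segal.exists_of_support (f : ∀ k, Segal (iter τ α k)) (m : ℕ)
    (h : ∀ k : ℤ, ¬ |k| ≤ m → f k = 0) : ∃ u : C0Segal τ α, ∀ k, u.1 k = f k := by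
  have hfin : (Set.range fun k => ‖f k‖).Finite := by
    refine (((Finset.Icc (-m : ℤ) m).finite_toSet.image fun k => ‖f k‖).insert 0).subset ?_
    rintro _ ⟨k, rfl⟩
    by_cases hk : |k| ≤ m
    · exact .inr ⟨k, Finset.mem_coe.2 (Finset.mem_Icc.2 (abs_le.1 hk)), rfl⟩
    · simp [h k hk]
  refine ⟨⟨⟨f, memℓp_infty hfin.bddAbove⟩, ?_, ?_⟩, fun _ => rfl⟩
  · refine tendsto_const_nhds.congr' ?_
    filter_upwards [eventually_gt_atTop (m : ℤ)] with k hk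
    exact (norm_eq_zero.2 (h k (not_le.2 (hk.trans_le (le_abs_self k))))).symm
  · refine tendsto_const_nhds.congr' ?_
    filter_upwards [eventually_lt_atBot (-m : ℤ)] with k hk
    exact (norm_eq_zero.2 (h k (not_le.2 (by rw [lt_abs]; omega)))).symm

/-- A uniform limit of null sequences is null, along any filter. -/
theorem isClosed_C0Segal : IsClosed (C0Segal τ α : Set (lp (fun k : ℤ => Segal (iter τ α k)) ∞)) := by
  have key : ∀ l : Filter ℤ, IsClosed
      {s : lp (fun k : ℤ => Segal (iter τ α k)) ∞ | Tendsto (fun k => ‖s k‖) l (𝓝 0)} := by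
    intro l
    refine isClosed_of_closure_subset fun s hs => ?_
    refine Metric.tendsto_nhds.2 fun ε hε => ?_
    obtain ⟨t, ht, hst⟩ := Metric.mem_closure_iff.1 hs (ε / 2) (half_pos hε)
    filter_upwards [Metric.tendsto_nhds.1 ht (ε / 2) (half_pos hε)] with k hk
    rw [dist_zero_right, norm_norm] at hk ⊢
    have h1 : ‖s k - t k‖ ≤ ‖s - t‖ := lp.norm_apply_le_norm ENNReal.top_ne_zero (s - t) k
    rw [dist_eq_norm] at hst
    have h2 := norm_sub_norm_le (s k) (t k)
    linarith
  exact (key atTop).inter (key atBot)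

instance : CompleteSpace (C0Segal τ α) := isClosed_C0Segal.completeSpace_coe

/-- The sequences supported in `K ∩ {|τ ∘ α ^ j| ≤ r}` at the indices `|j| ≤ m`. -/
def supportedIn (τ : ℝ →ᵇ ℂ) (α : ℝ ≃ₜ ℝ) (K : Set ℝ) (r : ℝ) (m : ℕ) : Set (C0Segal τ α) :=
  {s | ∀ j x, (s.1 j).1 x ≠ 0 → |j| ≤ m ∧ x ∈ K ∧ ‖iter τ α j x‖ ≤ r}

theorem supportedIn_mono {K L : Set ℝ} {r t : ℝ} {m n : ℕ} (hK : K ⊆ L) (hr : r ≤ t) (hm : m ≤ n) :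
    supportedIn τ α K r m ⊆ supportedIn τ α L t n := fun _ hs j x hx =>
  ⟨(hs j x hx).1.trans (by exact_mod_cast hm), hK (hs j x hx).2.1, (hs j x hx).2.2.trans hr⟩

/-- The finitely supported sequences whose entries vanish off a compact set on which the symbols
are bounded by some `r < 1`. -/
def compactlySupported (τ : ℝ →ᵇ ℂ) (α : ℝ ≃ₜ ℝ) : Set (C0Segal τ α) :=
  {s | ∃ K, IsCompact K ∧ ∃ r < 1, ∃ m, s ∈ supportedIn τ α K r m}

/-- Truncation discards the tails, which are small at both ends. Only finitely many entries remain,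
so the union of their compact sets is compact and the maximum of their bounds `r` is still below
one. -/
theorem dense_compactlySupported : Dense (compactlySupported τ α) := by
  refine Metric.dense_iff.2 fun s ε hε => ?_
  choose g hg K hK r hr hgK using fun j => (s.1 j).exists_near_compact (half_pos hε)
  obtain ⟨a, ha⟩ := eventually_atTop.1 (s.2.1.eventually_lt_const (half_pos hε))
  obtain ⟨b, hb⟩ := eventually_atBot.1 (s.2.2.eventually_lt_const (half_pos hε))
  let m : ℕ := max a.natAbs b.natAbs
  obtain ⟨u, hu⟩ := C0Segal.exists_of_support (fun k => if |k| ≤ m then g k else 0) m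
    fun k hk => if_neg hk
  let I := Finset.Icc (-m : ℤ) m
  have hI : I.Nonempty := ⟨0, by simp [I]⟩
  refine ⟨u, ?_, ⋃ j ∈ I, K j, I.isCompact_biUnion fun j _ => hK j, I.sup' hI r,
    (Finset.sup'_lt_iff hI).2 fun j _ => hr j, m, fun j x hx => ?_⟩
  · rw [Metric.mem_ball, dist_eq_norm, norm_sub_rev]
    refine (C0Segal.norm_le (half_pos hε).le fun j => ?_).trans_lt (half_lt_self hε)
    change ‖s.1 j - u.1 j‖ ≤ ε / 2
    rw [hu]
    by_cases hj : |j| ≤ m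
    · rw [if_pos hj]
      exact (hg j).le
    · rw [if_neg hj, sub_zero]
      rcases lt_abs.1 (not_le.1 hj) with h | h
      · exact (ha j (by omega)).le
      · exact (hb j (by omega)).le
  · rw [hu] at hx
    by_cases hj : |j| ≤ m
    · rw [if_pos hj] at hx
      have hjI : j ∈ I := Finset.mem_Icc.2 (abs_le.1 hj)
      exact ⟨hj, Set.mem_biUnion hjI (hgK j x hx).1,
        (hgK j x hx).2.trans (Finset.le_sup' r hjI)⟩
    · rw [if_neg hj] at hx
      exact absurd rfl hx

/-- On this set, reading off the entries in the window is bi-Lipschitz into a finite power of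
`C₀(ℝ)`: the geometric series gives the constant `(1 - r)⁻¹`. -/
theorem isSeparable_supportedIn [TopologicalSpace.SeparableSpace C₀(ℝ, ℂ)] {r : ℝ} (hr0 : 0 ≤ r)
    (hr : r < 1) (m : ℕ) : TopologicalSpace.IsSeparable (supportedIn τ α Set.univ r m) := by
  have : SecondCountableTopology C₀(ℝ, ℂ) := UniformSpace.secondCountable_of_separable _
  let I := Finset.Icc (-m : ℤ) m
  let φ : supportedIn τ α Set.univ r m → I → C₀(ℝ, ℂ) := fun s j => (s.1.1 j).1
  have hL : LipschitzWith 1 φ := LipschitzWith.of_dist_le_mul fun s t => by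
    rw [NNReal.coe_one, one_mul]
    refine (dist_pi_le_iff dist_nonneg).2 fun j => ?_
    rw [dist_eq_norm, Subtype.dist_eq, dist_eq_norm]
    exact (Segal.norm_coe_sub_le _ _).trans (C0Segal.norm_apply_le_norm (s.1 - t.1) j)
  have hr' : 0 ≤ (1 - r)⁻¹ := inv_nonneg.2 (sub_nonneg.2 hr.le)
  have hA : AntilipschitzWith ⟨(1 - r)⁻¹, hr'⟩ φ := AntilipschitzWith.of_le_mul_dist fun s t => by
    rw [Subtype.dist_eq, dist_eq_norm]
    refine C0Segal.norm_le (mul_nonneg hr' dist_nonneg) fun j => ?_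
    have hsupp : ∀ x, ((s.1 - t.1).1 j).1 x ≠ 0 → |j| ≤ m ∧ ‖iter τ α j x‖ ≤ r := by
      intro x hx
      by_cases h : (s.1.1 j).1 x = 0
      · have h' : (t.1.1 j).1 x ≠ 0 := fun h' => hx (by
          change (s.1.1 j).1 x - (t.1.1 j).1 x = 0
          rw [h, h', sub_zero])
        exact ⟨(t.2 j x h').1, (t.2 j x h').2.2⟩
      · exact ⟨(s.2 j x h).1, (s.2 j x h).2.2⟩
    refine (Segal.norm_le_of_symbol_le _ hr0 hr fun x hx => (hsupp x hx).2).trans ?_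
    refine mul_le_mul_of_nonneg_left ?_ hr'
    by_cases hj : |j| ≤ m
    · have := dist_le_pi_dist (φ s) (φ t) ⟨j, Finset.mem_Icc.2 (abs_le.1 hj)⟩
      rwa [dist_eq_norm] at this
    · refine norm_le_of_forall dist_nonneg fun x => ?_
      by_contra hx
      refine hj (hsupp x fun h0 => hx ?_).1
      rw [h0, norm_zero]
      exact dist_nonneg
  have := (hA.isUniformInducing hL.uniformContinuous).isInducing.secondCountableTopology
  exact .of_subtype _

theorem C0Segal.separableSpace [TopologicalSpace.SeparableSpace C₀(ℝ, ℂ)] :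
    TopologicalSpace.SeparableSpace (C0Segal τ α) := by
  -- A countable exhaustion: one parameter `m` bounds the indices and lets the symbol bound `1 - 1 /
  -- (m + 1)` increase to one.
  have h : TopologicalSpace.IsSeparable
      (⋃ m : ℕ, supportedIn τ α Set.univ (1 - 1 / ((m : ℝ) + 1)) m) :=
    .iUnion fun m => isSeparable_supportedIn
      (sub_nonneg.2 (by rw [div_le_one (by positivity)]; linarith [m.cast_nonneg (α := ℝ)]))
      (sub_lt_self _ (by positivity)) m
  rw [← TopologicalSpace.isSeparable_univ_iff, ← dense_compactlySupported.closure_eq]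
  refine (h.mono ?_).closure
  rintro s ⟨K, -, r, hr, m, hs⟩
  obtain ⟨n, hn⟩ := exists_nat_one_div_lt (sub_pos.2 hr)
  refine Set.mem_iUnion.2 ⟨max m n, supportedIn_mono K.subset_univ ?_ (le_max_left _ _) hs⟩
  have : 1 / (((max m n : ℕ) : ℝ) + 1) ≤ 1 / ((n : ℝ) + 1) :=
    one_div_le_one_div_of_le (by positivity) (by gcongr; exact le_max_right _ _)
  linarith

/-! ### Small right inverses and the transfer to `c₀` -/

/-- A bounded multiplier of norm at most `ε` that inverts `p` where `|p| ≥ ε⁻¹`. -/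
theorem exists_small_inverse (p : ℝ →ᵇ ℂ) {ε : ℝ} (hε : 0 < ε) :
    ∃ q : ℝ →ᵇ ℂ, (∀ x, ‖q x‖ ≤ ε) ∧ ∀ x, ε⁻¹ ≤ ‖p x‖ → p x * q x = 1 := by
  have hε' : 0 < ε⁻¹ := inv_pos.2 hε
  have hpos : ∀ x, 0 < max ‖p x‖ ε⁻¹ := fun x => lt_max_of_lt_right hε'
  -- Truncating the denominator of `p̄ / |p|²` from below at `ε⁻²` keeps the quotient continuous and
  -- bounded by `1 / max(|p|, ε⁻¹) ≤ ε`.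
  have hq : ∀ x, ‖star (p x) / ((max ‖p x‖ ε⁻¹ : ℝ) : ℂ) ^ 2‖ ≤ ε := fun x => by
    rw [norm_div, norm_star, norm_pow, Complex.norm_real, Real.norm_of_nonneg (hpos x).le,
      div_le_iff₀ (pow_pos (hpos x) 2)]
    have h1 : 1 ≤ ε * max ‖p x‖ ε⁻¹ := by
      rw [← inv_le_iff_one_le_mul₀' hε]
      exact le_max_right _ _
    nlinarith [le_max_left ‖p x‖ ε⁻¹, hpos x]
  refine ⟨.ofNormedAddCommGroup (fun x => star (p x) / ((max ‖p x‖ ε⁻¹ : ℝ) : ℂ) ^ 2) ?_ ε hq,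
    hq, fun x hx => ?_⟩
  · refine Continuous.div (by fun_prop) (by fun_prop) fun x => pow_ne_zero 2 ?_
    exact Complex.ofReal_ne_zero.2 (hpos x).ne'
  · change p x * (star (p x) / ((max ‖p x‖ ε⁻¹ : ℝ) : ℂ) ^ 2) = 1
    have h0 : (‖p x‖ : ℂ) ≠ 0 := Complex.ofReal_ne_zero.2 (hε'.trans_le hx).ne'
    rw [max_eq_left hx, ← mul_div_assoc, div_eq_one_iff_eq (pow_ne_zero 2 h0)]
    exact RCLike.mul_conj (p x)

/-- Hypercyclicity of the weighted shift passes from `ℓ²(C₀(ℝ))` to `c₀^{A,τ}`. -/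
theorem Hypercyclic.shiftC0 (τ : ℝ →ᵇ ℂ) {α : ℝ ≃ₜ ℝ} {W : ℤ → ℝ →ᵇ ℂ}
    {hW : BddAbove (Set.range fun j => ‖W j‖)} (h : Hypercyclic (shiftL2 α W hW)) :
    Hypercyclic (shiftC0 τ α W hW) := by
  have := h.separableSpace
  have : TopologicalSpace.SeparableSpace C₀(ℝ, ℂ) := L2.separableSpace_of_separableSpace
  have : TopologicalSpace.SeparableSpace (C0Segal τ α) := C0Segal.separableSpace
  refine Hypercyclic.of_dense _ dense_compactlySupported ?_
  rintro f ⟨K, hK, r, -, m, hf⟩ g ⟨L, hL, t, -, m', hg⟩ ε hε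
  have hC : 0 < ‖f‖ + ‖g‖ + 1 := by positivity
  have hδ : 0 < ε / (‖f‖ + ‖g‖ + 1) := by positivity
  set δ := ε / (‖f‖ + ‖g‖ + 1) with hδ_def
  have hδf : δ * ‖f‖ < ε := by
    rw [hδ_def, div_mul_eq_mul_div, div_lt_iff₀ hC]
    nlinarith [norm_nonneg g]
  have hδg : δ * ‖g‖ < ε := by
    rw [hδ_def, div_mul_eq_mul_div, div_lt_iff₀ hC]
    nlinarith [norm_nonneg f]
  obtain ⟨n, hn⟩ := exists_iterWeight_small_large α hW h (hK.union hL) (max m m') hδ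
  replace hf := supportedIn_mono (L := K ∪ L) Set.subset_union_left le_rfl (le_max_left m m') hf
  replace hg := supportedIn_mono (L := K ∪ L) Set.subset_union_right le_rfl (le_max_right m m') hg
  choose q hq hpq using fun j => exists_small_inverse (iterWeight α W n j) hδ
  -- This `v` is `T ^ n f` itself, as `hvf` records; the domination lemma is used only for its norm
  -- bound.
  obtain ⟨v, hv, hvn⟩ := C0Segal.exists_of_le f (fun j => (((SegalShift.shiftC0 τ α W hW ^ n) f).1 j).1) (-n) hδ.le
    fun j x => by
      rw [shiftC0_pow_apply, norm_mul, neg_neg, ← sub_eq_add_neg]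
      by_cases hx : (f.1 (j - n)).1 ((α ^ (n : ℤ) : ℝ ≃ₜ ℝ) x) = 0
      · rw [hx, norm_zero, mul_zero, mul_zero]
      · obtain ⟨h1, h2, -⟩ := hf _ _ hx
        -- The small-weight estimate is taken at index `j - n` and at the point `α ^ n x`, where `f`
        -- is supported.
        have h3 := (hn _ h1 _ h2).1
        rw [sub_add_cancel, zpow_neg_zpow_apply] at h3
        exact mul_le_mul_of_nonneg_right h3 (norm_nonneg _)
  -- The candidate preimage has entries `u_i = (q_{i+n} · g_{i+n}) ∘ α ^ (-n)`, so applying `T ^ n`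
  -- leaves `p_{n,j} · q_j · g_j`, and `p_{n,j} · q_j = 1` wherever `g_j ≠ 0`.
  obtain ⟨u, hu, hun⟩ := C0Segal.exists_of_le g (fun i => ZeroAtInftyContinuousMap.compLinearMap (R := ℂ)
      (α ^ (-(n : ℤ)) : ℝ ≃ₜ ℝ).toCocompactMap (mulCb (q (i + n)) (g.1 (i + n)).1)) n hδ.le
    fun i x => by
      change ‖q (i + n) _ * (g.1 (i + n)).1 _‖ ≤ _
      rw [norm_mul]
      exact mul_le_mul_of_nonneg_right (hq _ _) (norm_nonneg _)
  refine ⟨n, u, ?_, hun.trans_lt hδg, ?_⟩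
  · have hvf : v = (SegalShift.shiftC0 τ α W hW ^ n) f :=
      Subtype.ext (lp.ext (funext fun j => Subtype.ext (hv j)))
    exact hvf ▸ hvn.trans_lt hδf
  · refine Subtype.ext (lp.ext (funext fun j => Subtype.ext (DFunLike.ext _ _ fun x => ?_)))
    rw [shiftC0_pow_apply, hu, sub_add_cancel]
    change iterWeight α W n j x * (q j ((α ^ (-(n : ℤ)) : ℝ ≃ₜ ℝ) _) *
      (g.1 j).1 ((α ^ (-(n : ℤ)) : ℝ ≃ₜ ℝ) _)) = _
    rw [zpow_neg_zpow_apply, ← mul_assoc]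
    by_cases hx : (g.1 j).1 x = 0
    · rw [hx, mul_zero]
    · obtain ⟨h1, h2, -⟩ := hg _ _ hx
      rw [hpq j x (hn j h1 x h2).2, one_mul]

end SegalShift

theorem mainTheorem11 (τ : ℝ →ᵇ ℂ) (α : ℝ ≃ₜ ℝ) (W : ℤ → ℝ →ᵇ ℂ)
    (hW : BddAbove (Set.range fun j => ‖W j‖))
    (h : SegalShift.Hypercyclic (SegalShift.shiftL2 α W hW)) :
    SegalShift.Hypercyclic (SegalShift.shiftC0 τ α W hW) := by
  exact h.shiftC0 τ
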